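/- **Setting.** For each sample size $n$, let $X$ be an $n\times p$ matrix and consider the models $M_k$, one for each subset $k$ of the columns of $X$ with $p_k\le\bar p$ elements, where $\bar p\le p$ and $X_k'X_k$ is invertible for all these $k$. Under $M_k$, $y\sim N(X_k\theta_k,\phi^* I)$ with known variance $\phi^*>0$ and Zellner's prior $\theta_k\sim N(0,\tau\phi^*(X_k'X_k)^{-1})$, $\tau>0$. The prior probability $p(M_k)>0$ depends on $k$ only through $p_k$, and $r_{p_k,p_l}=p(M_k)/p(M_l)$. The truth is $f^*(y)=N(y;X_t\theta_t^*,\phi^* I)$ for a candidate model $M_t$, and $E_{f^*}$ is the expectation under $f^*$. All quantities may depend on $n$, and limits are as $n\to\infty$. Write $a_n\ll b_n$ if $b_n>0$ for large $n$ and $\lim a_n/b_n=0$ (if $a_n$ may be non-positive, $\limsup a_n/b_n\le 0$), and $a_n\preceq b_n$ if $a_n\le c\,b_n$ for some constant $c$ and all large $n$. Let $$g=(1+\tau)^{(p_m-p_t)/2}\,r_{p_t,p_m},\qquad \lambda_{tm}=(X_t\theta_t^*)'\bigl(I-X_m(X_m'X_m)^{-1}X_m'\bigr)X_t\theta_t^*/\phi^*.$$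 The conditions are: - (B1) $\bar p\ll\min\{n,p\}$ and $\tau\gg\bar p$. - (B2) $\lambda_{tm}^{\beta_1}\gg p_q$ for some constant $\beta_1\in(0,1)$, where $M_q=M_t\cup M_m$. - (C1) $\tau\gg1$ and $r_{p_m,p_t}\ll\tau^{\beta_2(p_m-p_t)/2}$ for some fixed $\beta_2\in(0,1)$. - (C2) $\log r_{p_m,p_t}\ll\lambda_{tm}^{\beta_3}+(p_m-p_t)\log(1+\tau)$ for all fixed $\beta_3\in(0,1)$. **Proposition.** (i) Let $M_m$ be spurious ($M_t\subsetneq M_m$, $p_m\le\bar p$) and assume (B1) and (C1). Then $$E_{f^*}(p(M_m\mid y))\preceq\frac{[\log g]^{(p_m-p_t)/2}}{g}\qquad\text{and}\qquad E_{f^*}(p(M_m\mid y))\ll\frac{r_{p_m,p_t}^{\alpha}}{\tau^{\alpha(p_m-p_t)/2}}\ \text{ for every fixed }\alpha\in(0,1).$$ If moreover $(p_m-p_t)\log\log g\ll\log g$ (for instance if $p_m-p_t$ is bounded), then also $$\frac{[\log g]^{(p_m-p_t)/2}}{g}\ll\frac{r_{p_m,p_t}^{\alpha}}{\tau^{\alpha(p_m-p_t)/2}}\quad\text{for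 every fixed }\alpha\in(0,1).$$ (ii) Let $M_m$ be non-spurious ($M_t\not\subseteq M_m$, $p_m\le\bar p$), assume (B2) and (C2), and let $\tau$ be bounded away from $0$. Then, for all fixed $\alpha',\gamma\in(0,1)$, $$E_{f^*}(p(M_m\mid y))\ll e^{-\gamma\lambda_{tm}/2}+e^{-\gamma\lambda_{tm}^{\alpha'}/2}.$$ -/

import Mathlib

open MeasureTheory ProbabilityTheory Filter Asymptotics
open scoped Matrix Topology

/-- The columns of the design matrix `X` that are selected by the model `k`. -/
def selectCols {n p : ℕ} (X : Matrix (Fin n) (Fin p) ℝ) (k : Finset (Fin p)) :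
    Matrix (Fin n) k ℝ :=
  X.submatrix id Subtype.val

/-- The data of the variable selection problem at sample size `n`: a linear regression with known
error variance, Zellner's prior, a prior on models, and a Gaussian truth. Models are the subsets
of the `p` columns of `X` with at most `pbar` elements. -/
structure ZellnerRegression (n : ℕ) where
  /-- number of covariates -/
  p : ℕ
  /-- maximum model size -/
  pbar : ℕ
  pbar_le : pbar ≤ p
  /-- design matrix -/
  X : Matrix (Fin n) (Fin p) ℝ
  gram_isUnit : ∀ k : Finset (Fin p), k.card ≤ pbar →
    IsUnit ((selectCols X k)ᵀ * selectCols X k)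
  /-- prior dispersion -/
  τ : ℝ
  τ_pos : 0 < τ
  /-- known error variance -/
  φ : ℝ
  φ_pos : 0 < φ
  /-- `modelPrior l` is the prior probability of each single model that has `l` variables -/
  modelPrior : ℕ → ℝ
  modelPrior_pos : ∀ l ≤ pbar, 0 < modelPrior l
  modelPrior_sum :
    ∑ k ∈ (Finset.univ : Finset (Finset (Fin p))).filter (fun k => k.card ≤ pbar),
      modelPrior k.card = 1
  /-- the data-generating model -/
  t : Finset (Fin p)
  t_card_le : t.card ≤ pbar
  /-- the data-generating regression coefficients -/
  θstar : t → ℝ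

namespace ZellnerRegression

variable {n : ℕ} (D : ZellnerRegression n)

/-- The set of candidate models. -/
def models : Finset (Finset (Fin D.p)) :=
  Finset.univ.filter (fun k => k.card ≤ D.pbar)

/-- The design matrix of the model `k`. -/
def Xsub (k : Finset (Fin D.p)) : Matrix (Fin n) k ℝ := selectCols D.X k

/-- The Gram matrix of the design matrix of the model `k`. -/
def gram (k : Finset (Fin D.p)) : Matrix k k ℝ := (D.Xsub k)ᵀ * D.Xsub k

/-- The true mean of the response. -/
def trueMean : Fin n → ℝ := D.Xsub D.t *ᵥ D.θstar

/-- The law of the response under the truth, a Gaussian law with covariance `φ I`. -/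
noncomputable def truth : Measure (EuclideanSpace ℝ (Fin n)) :=
  multivariateGaussian (WithLp.toLp 2 D.trueMean) (D.φ • (1 : Matrix (Fin n) (Fin n) ℝ))

/-- The likelihood of model `k`: the density at `y` of the Gaussian law on `ℝⁿ` with mean `X_k θ`
and covariance `φ I`. -/
noncomputable def likelihood (k : Finset (Fin D.p)) (θ : EuclideanSpace ℝ k)
    (y : EuclideanSpace ℝ (Fin n)) : ℝ :=
  (√(2 * Real.pi * D.φ) ^ n)⁻¹ *
    Real.exp (-‖y - WithLp.toLp 2 (D.Xsub k *ᵥ θ.ofLp)‖ ^ 2 / (2 * D.φ))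

/-- Zellner's prior on the coefficients of model `k`. -/
noncomputable def coefPrior (k : Finset (Fin D.p)) : Measure (EuclideanSpace ℝ k) :=
  multivariateGaussian 0 ((D.τ * D.φ) • (D.gram k)⁻¹)

/-- The integrated likelihood of model `k`. -/
noncomputable def marginal (k : Finset (Fin D.p)) (y : EuclideanSpace ℝ (Fin n)) : ℝ :=
  ∫ θ, D.likelihood k θ y ∂(D.coefPrior k)

/-- The Bayes factor between the models `l` and `k`. -/
noncomputable def bayesFactor (l k : Finset (Fin D.p)) (y : EuclideanSpace ℝ (Fin n)) : ℝ :=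
  D.marginal l y / D.marginal k y

/-- The ratio of the prior probabilities of a model of size `a` and one of size `b`. -/
noncomputable def priorRatio (a b : ℕ) : ℝ := D.modelPrior a / D.modelPrior b

/-- The posterior probability of model `k`. -/
noncomputable def posterior (k : Finset (Fin D.p)) (y : EuclideanSpace ℝ (Fin n)) : ℝ :=
  (1 + ∑ l ∈ D.models.erase k, D.bayesFactor l k y * D.priorRatio l.card k.card)⁻¹

/-- The mean under the truth of the posterior probability of model `k`. -/
noncomputable def meanPosterior (k : Finset (Fin D.p)) : ℝ :=
  ∫ y, D.posterior k y ∂D.truth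

/-- Spurious models: they contain the data-generating one and at least one more variable. -/
def IsSpurious (m : Finset (Fin D.p)) : Prop := m ∈ D.models ∧ D.t ⊂ m

/-- Non-spurious models: they do not contain the data-generating one. -/
def IsNonSpurious (m : Finset (Fin D.p)) : Prop := m ∈ D.models ∧ ¬ D.t ⊆ m

/-- The difference `p_m - p_t` in the number of variables, as a real number. -/
def dimDiff (m : Finset (Fin D.p)) : ℝ := (m.card : ℝ) - (D.t.card : ℝ)

/-- The prior ratio `r_{p_m, p_t}`. -/
noncomputable def ratio (m : Finset (Fin D.p)) : ℝ := D.priorRatio m.card D.t.card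

/-- `g = (1 + τ) ^ ((p_m - p_t) / 2) * r_{p_t, p_m}`. -/
noncomputable def g (m : Finset (Fin D.p)) : ℝ :=
  (1 + D.τ) ^ (D.dimDiff m / 2) * D.priorRatio D.t.card m.card

/-- The non-centrality parameter `λ_{tm}`. -/
noncomputable def noncentrality (m : Finset (Fin D.p)) : ℝ :=
  (D.trueMean ⬝ᵥ
    ((1 - D.Xsub m * (D.gram m)⁻¹ * (D.Xsub m)ᵀ) *ᵥ D.trueMean)) / D.φ

/-- `[log g] ^ ((p_m - p_t) / 2) / g`. -/
noncomputable def logRate (m : Finset (Fin D.p)) : ℝ :=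
  Real.log (D.g m) ^ (D.dimDiff m / 2) / D.g m

/-- `r_{p_m, p_t} ^ α / τ ^ (α (p_m - p_t) / 2)`. -/
noncomputable def powerRate (α : ℝ) (m : Finset (Fin D.p)) : ℝ :=
  D.ratio m ^ α / D.τ ^ (α * D.dimDiff m / 2)

end ZellnerRegression

/-- The maximum model size is of smaller order than `min n p` and than the prior dispersion. -/
def CondB1 (D : ∀ n, ZellnerRegression n) : Prop :=
  ((fun n => ((D n).pbar : ℝ)) =o[atTop] fun n => ((min n (D n).p : ℕ) : ℝ)) ∧
  ((fun n => ((D n).pbar : ℝ)) =o[atTop] fun n => (D n).τ)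

/-- The size of the union of `M_t` and `M_m` is of smaller order than a power `β₁ < 1` of the
non-centrality parameter. -/
def CondB2 (D : ∀ n, ZellnerRegression n) (m : ∀ n, Finset (Fin (D n).p)) : Prop :=
  ∃ β₁ ∈ Set.Ioo (0 : ℝ) 1,
    (fun n => (((D n).t ∪ m n).card : ℝ)) =o[atTop] fun n => (D n).noncentrality (m n) ^ β₁

/-- `τ ≫ 1`, and `r_{p_m, p_t} ≪ τ ^ (β₂ (p_m - p_t) / 2)` for some `β₂ ∈ (0, 1)`. -/
def CondC1 (D : ∀ n, ZellnerRegression n) (m : ∀ n, Finset (Fin (D n).p)) : Prop :=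
  Tendsto (fun n => (D n).τ) atTop atTop ∧
  ∃ β₂ ∈ Set.Ioo (0 : ℝ) 1,
    (fun n => (D n).ratio (m n)) =o[atTop] fun n => (D n).τ ^ (β₂ * (D n).dimDiff (m n) / 2)

/-- `log r_{p_m, p_t} ≪ λ_{tm} ^ β₃ + (p_m - p_t) log (1 + τ)` for every `β₃ ∈ (0, 1)`.
The right side of `≪` has to be positive for large `n`; the left side may have any sign, hence the
relation is stated as a one-sided bound, which is the usual one when the left side is positive. -/
def CondC2 (D : ∀ n, ZellnerRegression n) (m : ∀ n, Finset (Fin (D n).p)) : Prop :=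
  ∀ β₃ ∈ Set.Ioo (0 : ℝ) 1,
    (∀ᶠ n in atTop, 0 < (D n).noncentrality (m n) ^ β₃ +
      (D n).dimDiff (m n) * Real.log (1 + (D n).τ)) ∧
    ∀ ε > 0, ∀ᶠ n in atTop, Real.log ((D n).ratio (m n)) ≤
      ε * ((D n).noncentrality (m n) ^ β₃ + (D n).dimDiff (m n) * Real.log (1 + (D n).τ))

/-! Keeping only the true model in the denominator, the posterior probability of `m` is at most `(1
+ B)⁻¹`, where `B` is its posterior odds against `m`. Hence it is at most `B ^ (-σ)` for every `σ ∈
[0, 1]` (`posterior_le`). Under Zellner's prior, `B` is `g` times the exponential of a difference of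
squared projections of `y` (`bayesFactor_mul_priorRatio`). The mean posterior is therefore
controlled by a Gaussian exponential moment, with `σ` free to choose (`meanPosterior_le`).

Spurious case: the difference is the squared projection onto the `d = p_m - p_t` extra directions,
where the true mean vanishes, so the bound is `g ^ (-σ) * (1 - σ) ^ (-d / 2)`. Its minimiser `1 - σ
= d / (2 log g)` gives the logarithmic rate. A fixed `σ` strictly between `α` and `1` gives the
power rate, because (C1) makes `d` negligible against `log g`.

Non-spurious case: with `U` the span of the columns of both models, the difference is at most twice
the squared noise in `U` minus half the squared distance from the true mean to the span of `m`. With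
`σ = 1 / 4` the bound is `g ^ (-1/4)` times an exponential decaying linearly in `λ`, times `2 ^
p_q`. By (B2) and (C2) the other factors cost only powers of `λ` below one in the exponent. Linear
decay then beats the second summand of the stated rate on its own. -/

section GaussianQuadratic

/-! ### Exponential moments of quadratic forms in a standard Gaussian vector. -/

theorem integral_exp_quadratic_gaussianReal {a : ℝ} (ha : a < 1 / 2) (b : ℝ) :
    ∫ x, Real.exp (a * x ^ 2 + b * x) ∂(gaussianReal 0 1) =
      (√(1 - 2 * a))⁻¹ * Real.exp (b ^ 2 / (2 * (1 - 2 * a))) := by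
  have hv : 0 < 1 - 2 * a := by linarith
  rw [integral_gaussianReal_eq_integral_smul one_ne_zero]
  have key : ∀ x : ℝ, gaussianPDFReal 0 1 x • Real.exp (a * x ^ 2 + b * x) =
      ((√(2 * Real.pi))⁻¹ * Real.exp (b ^ 2 / (2 * (1 - 2 * a)))) *
        Real.exp (-((1 - 2 * a) / 2) * (x - b / (1 - 2 * a)) ^ 2) := by
    intro x
    simp only [gaussianPDFReal, smul_eq_mul, NNReal.coe_one, mul_one]
    rw [mul_assoc (√(2 * Real.pi))⁻¹, mul_assoc (√(2 * Real.pi))⁻¹, ← Real.exp_add,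
      ← Real.exp_add]
    congr 2
    field_simp
    ring
  simp_rw [key]
  rw [integral_const_mul,
    integral_sub_right_eq_self (fun x => Real.exp (-((1 - 2 * a) / 2) * x ^ 2)),
    integral_gaussian]
  have h : Real.pi / ((1 - 2 * a) / 2) = 2 * Real.pi / (1 - 2 * a) := by field_simp
  rw [h, Real.sqrt_div (by positivity)]
  have : √(2 * Real.pi) ≠ 0 := by positivity
  field_simp

variable {E : Type*} [NormedAddCommGroup E] [InnerProductSpace ℝ E] [FiniteDimensional ℝ E]
  [MeasurableSpace E] [BorelSpace E]

theorem integral_exp_quadratic_stdGaussian {a : ℝ} (ha : a < 1 / 2) (b : E) :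
    ∫ x, Real.exp (a * ‖x‖ ^ 2 + inner ℝ b x) ∂(stdGaussian E) =
      (√(1 - 2 * a))⁻¹ ^ Module.finrank ℝ E * Real.exp (‖b‖ ^ 2 / (2 * (1 - 2 * a))) := by
  have e := stdOrthonormalBasis ℝ E
  rw [stdGaussian_eq_map_pi_orthonormalBasis e, integral_map (Measurable.aemeasurable (by fun_prop))
    (Measurable.aestronglyMeasurable (by fun_prop))]
  have h1 : ∀ x : Fin (Module.finrank ℝ E) → ℝ,
      Real.exp (a * ‖∑ i, x i • e i‖ ^ 2 + inner ℝ b (∑ i, x i • e i)) =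
        ∏ i, Real.exp (a * x i ^ 2 + inner ℝ b (e i) * x i) := by
    intro x
    rw [← Real.exp_sum, ← e.sum_sq_inner_right, Finset.sum_add_distrib, Finset.mul_sum, inner_sum]
    congr 2
    · exact Finset.sum_congr rfl fun i _ => by rw [e.orthonormal.inner_right_fintype]
    · exact Finset.sum_congr rfl fun i _ => by rw [real_inner_smul_right, mul_comm]
  simp_rw [h1]
  rw [integral_fintype_prod_eq_prod
    (f := fun i (x : ℝ) => Real.exp (a * x ^ 2 + inner ℝ b (e i) * x))]
  simp_rw [integral_exp_quadratic_gaussianReal ha]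
  rw [Finset.prod_mul_distrib, ← Real.exp_sum, ← Finset.sum_div, e.sum_sq_inner_left]
  simp

theorem charFun_map_continuousLinearMap {F : Type*} [NormedAddCommGroup F]
    [InnerProductSpace ℝ F] [FiniteDimensional ℝ F] [MeasurableSpace F] [BorelSpace F]
    (μ : Measure E) (A : E →L[ℝ] F) (t : F) :
    charFun (μ.map A) t = charFun μ (A.adjoint t) := by
  rw [charFun_apply, charFun_apply, integral_map (by fun_prop)
    (Measurable.aestronglyMeasurable (by fun_prop))]
  simp_rw [ContinuousLinearMap.adjoint_inner_right]

theorem map_orthogonalProjection_stdGaussian (K : Submodule ℝ E) :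
    (stdGaussian E).map K.orthogonalProjectionOnto = stdGaussian K := by
  apply Measure.ext_of_charFun
  ext t
  rw [charFun_map_continuousLinearMap, Submodule.adjoint_orthogonalProjectionOnto,
    charFun_stdGaussian, charFun_stdGaussian]
  simp

theorem integral_exp_quadratic_proj_stdGaussian (K : Submodule ℝ E) {a : ℝ} (ha : a < 1 / 2)
    (b : E) :
    ∫ x, Real.exp (a * ‖K.starProjection x‖ ^ 2 + inner ℝ b (K.starProjection x))
        ∂(stdGaussian E) =
      (√(1 - 2 * a))⁻¹ ^ Module.finrank ℝ K *
        Real.exp (‖K.starProjection b‖ ^ 2 / (2 * (1 - 2 * a))) := by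
  have h := integral_exp_quadratic_stdGaussian ha (K.orthogonalProjectionOnto b)
  rw [← map_orthogonalProjection_stdGaussian K, integral_map (by fun_prop)
    (Measurable.aestronglyMeasurable (by fun_prop))] at h
  simp_rw [← Submodule.norm_coe, ← Submodule.starProjection_apply] at h
  convert h using 5 with x
  rw [Submodule.coe_inner, ← Submodule.starProjection_apply, ← Submodule.starProjection_apply,
    K.inner_starProjection_left_eq_right,
    Submodule.starProjection_eq_self_iff.2 (K.starProjection_apply_mem x)]

theorem integrable_exp_sq_proj_stdGaussian (K : Submodule ℝ E) {a : ℝ} (ha : a < 1 / 2) :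
    Integrable (fun x => Real.exp (a * ‖K.starProjection x‖ ^ 2)) (stdGaussian E) := by
  have h := integral_exp_quadratic_proj_stdGaussian K ha 0
  simp only [inner_zero_left, add_zero] at h
  -- The Bochner integral of a non-integrable function is 0 by convention, so a nonzero value proves
  -- integrability.
  refine Integrable.of_integral_ne_zero ?_
  rw [h]
  have : 0 < 1 - 2 * a := by linarith
  positivity

theorem integral_exp_sq_proj_stdGaussian (K : Submodule ℝ E) {a : ℝ} (ha : a < 1 / 2) :
    ∫ x, Real.exp (a * ‖K.starProjection x‖ ^ 2) ∂(stdGaussian E) =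
      (√(1 - 2 * a))⁻¹ ^ Module.finrank ℝ K := by
  simpa using integral_exp_quadratic_proj_stdGaussian K ha 0

end GaussianQuadratic

/-! ### Column spaces, the closed form of the integrated likelihood, and the truth as an affine
Gaussian image. -/

namespace ZellnerRegression

variable {n : ℕ} (D : ZellnerRegression n)

/-- The map `θ ↦ X_k θ`. -/
noncomputable def colMap (k : Finset (Fin D.p)) :
    EuclideanSpace ℝ k →L[ℝ] EuclideanSpace ℝ (Fin n) :=
  (Matrix.toEuclideanLin (D.Xsub k)).toContinuousLinearMap

theorem colMap_apply (k : Finset (Fin D.p)) (θ : EuclideanSpace ℝ k) :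
    D.colMap k θ = WithLp.toLp 2 (D.Xsub k *ᵥ θ.ofLp) := rfl

theorem adjoint_colMap_apply (k : Finset (Fin D.p)) (y : EuclideanSpace ℝ (Fin n)) :
    (D.colMap k).adjoint y = WithLp.toLp 2 ((D.Xsub k)ᵀ *ᵥ y.ofLp) := by
  refine ext_inner_right ℝ fun θ => ?_
  rw [ContinuousLinearMap.adjoint_inner_left, colMap_apply]
  simp only [EuclideanSpace.inner_eq_star_dotProduct, star_trivial]
  rw [dotProduct_comm, Matrix.dotProduct_mulVec, Matrix.mulVec_transpose,
    dotProduct_comm]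

/-- The space spanned by the columns of the design matrix of the model `k`. -/
noncomputable def colSpan (k : Finset (Fin D.p)) : Submodule ℝ (EuclideanSpace ℝ (Fin n)) :=
  LinearMap.range (D.colMap k : EuclideanSpace ℝ k →ₗ[ℝ] EuclideanSpace ℝ (Fin n))

theorem colMap_mem (k : Finset (Fin D.p)) (θ : EuclideanSpace ℝ k) :
    D.colMap k θ ∈ D.colSpan k := ⟨θ, rfl⟩

variable {D}

theorem gram_isUnit_det {k : Finset (Fin D.p)} (hk : k.card ≤ D.pbar) : IsUnit (D.gram k).det :=
  (Matrix.isUnit_iff_isUnit_det _).1 (D.gram_isUnit k hk)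

theorem starProjection_colSpan {k : Finset (Fin D.p)} (hk : k.card ≤ D.pbar)
    (y : EuclideanSpace ℝ (Fin n)) :
    (D.colSpan k).starProjection y =
      WithLp.toLp 2 ((D.Xsub k * (D.gram k)⁻¹ * (D.Xsub k)ᵀ) *ᵥ y.ofLp) := by
  have h : WithLp.toLp 2 ((D.Xsub k * (D.gram k)⁻¹ * (D.Xsub k)ᵀ) *ᵥ y.ofLp) =
      D.colMap k (WithLp.toLp 2 (((D.gram k)⁻¹ * (D.Xsub k)ᵀ) *ᵥ y.ofLp)) := by
    rw [colMap_apply, Matrix.mulVec_mulVec, Matrix.mul_assoc]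
  refine Submodule.eq_starProjection_of_mem_of_inner_eq_zero (h ▸ D.colMap_mem k _) ?_
  rintro _ ⟨θ, rfl⟩
  change inner ℝ _ (D.colMap k θ) = 0
  rw [← ContinuousLinearMap.adjoint_inner_left, map_sub, adjoint_colMap_apply,
    adjoint_colMap_apply]
  simp only
  rw [Matrix.mulVec_mulVec, Matrix.mul_assoc, ← Matrix.mul_assoc (D.Xsub k)ᵀ]
  change inner ℝ (_ - WithLp.toLp 2 ((D.gram k * ((D.gram k)⁻¹ * (D.Xsub k)ᵀ)) *ᵥ y.ofLp)) θ = 0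
  rw [Matrix.mul_nonsing_inv_cancel_left _ _ (gram_isUnit_det hk), sub_self, inner_zero_left]

theorem finrank_colSpan_le (k : Finset (Fin D.p)) :
    Module.finrank ℝ (D.colSpan k) ≤ k.card := by
  refine (LinearMap.finrank_range_le _).trans ?_
  simp

theorem colMap_injective {k : Finset (Fin D.p)} (hk : k.card ≤ D.pbar) :
    Function.Injective (D.colMap k) := by
  have h : Function.LeftInverse
      (fun y => WithLp.toLp 2 (((D.gram k)⁻¹ * (D.Xsub k)ᵀ) *ᵥ y.ofLp)) (D.colMap k) := by
    intro θ
    simp only [colMap_apply, Matrix.mulVec_mulVec, Matrix.mul_assoc]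
    change WithLp.toLp 2 (((D.gram k)⁻¹ * D.gram k) *ᵥ θ.ofLp) = θ
    rw [Matrix.nonsing_inv_mul _ (gram_isUnit_det hk), Matrix.one_mulVec]
  exact h.injective

theorem finrank_colSpan {k : Finset (Fin D.p)} (hk : k.card ≤ D.pbar) :
    Module.finrank ℝ (D.colSpan k) = k.card := by
  rw [colSpan, LinearMap.finrank_range_of_inj (colMap_injective hk)]
  simp

theorem colSpan_mono {k l : Finset (Fin D.p)} (h : k ⊆ l) : D.colSpan k ≤ D.colSpan l := by
  rintro _ ⟨θ, rfl⟩
  refine ⟨WithLp.toLp 2 fun j => if hj : j.1 ∈ k then θ ⟨j.1, hj⟩ else 0, ?_⟩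
  change D.colMap l _ = D.colMap k θ
  rw [colMap_apply, colMap_apply]
  congr 1
  ext i
  simp only [Matrix.mulVec, dotProduct, Xsub, selectCols, Matrix.submatrix_apply, id]
  rw [Finset.sum_coe_sort l (fun j => D.X i j * if hj : j ∈ k then θ ⟨j, hj⟩ else 0),
    ← Finset.sum_subset h (fun j _ hj => by simp [hj]), ← Finset.sum_coe_sort k]
  exact Finset.sum_congr rfl fun j _ => by simp

theorem coefPrior_cov_posSemidef (k : Finset (Fin D.p)) :
    ((D.τ * D.φ) • (D.gram k)⁻¹).PosSemidef := by
  have h : (D.gram k).PosSemidef := by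
    have := Matrix.posSemidef_conjTranspose_mul_self (D.Xsub k)
    rwa [Matrix.conjTranspose_eq_transpose_of_trivial] at this
  exact h.inv.smul (mul_pos D.τ_pos D.φ_pos).le

/-- The covariance of `X_k θ` is `τ φ X_k (X_k' X_k)⁻¹ X_k'`, a multiple of the orthogonal
projection onto the column space. Passing to this law removes all Gram determinants from the
marginal. -/
theorem map_colMap_coefPrior {k : Finset (Fin D.p)} (hk : k.card ≤ D.pbar) :
    (D.coefPrior k).map (D.colMap k) =
      (stdGaussian (EuclideanSpace ℝ (Fin n))).map
        (√(D.τ * D.φ) • (D.colSpan k).starProjection) := by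
  have : IsFiniteMeasure (D.coefPrior k) := by unfold coefPrior; infer_instance
  apply Measure.ext_of_charFun
  ext y
  rw [charFun_map_continuousLinearMap, charFun_map_continuousLinearMap, charFun_stdGaussian,
    coefPrior, charFun_multivariateGaussian (coefPrior_cov_posSemidef k), adjoint_colMap_apply]
  have hadj : ((√(D.τ * D.φ) • (D.colSpan k).starProjection).adjoint) y =
      √(D.τ * D.φ) • (D.colSpan k).starProjection y := by
    refine ext_inner_right ℝ fun z => ?_
    rw [ContinuousLinearMap.adjoint_inner_left]
    simp [real_inner_smul_left, real_inner_smul_right,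
      Submodule.inner_starProjection_left_eq_right]
  rw [hadj]
  have hq : ‖(√(D.τ * D.φ)) • (D.colSpan k).starProjection y‖ ^ 2 =
      ((D.Xsub k)ᵀ *ᵥ y.ofLp) ⬝ᵥ
        (((D.τ * D.φ) • (D.gram k)⁻¹) *ᵥ ((D.Xsub k)ᵀ *ᵥ y.ofLp)) := by
    rw [norm_smul, mul_pow, Real.norm_eq_abs, sq_abs,
      Real.sq_sqrt (mul_pos D.τ_pos D.φ_pos).le, ← real_inner_self_eq_norm_sq,
      Submodule.inner_starProjection_left_eq_right,
      Submodule.starProjection_eq_self_iff.2 (Submodule.starProjection_apply_mem _ y),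
      starProjection_colSpan hk, EuclideanSpace.inner_eq_star_dotProduct, star_trivial,
      Matrix.smul_mulVec, dotProduct_smul, smul_eq_mul, Matrix.mul_assoc,
      ← Matrix.mulVec_mulVec, ← Matrix.mulVec_mulVec, dotProduct_comm,
      Matrix.dotProduct_mulVec, ← Matrix.mulVec_transpose]
  rw [← Complex.ofReal_pow, hq]
  simp [neg_div]

theorem marginal_eq {k : Finset (Fin D.p)} (hk : k.card ≤ D.pbar)
    (y : EuclideanSpace ℝ (Fin n)) :
    D.marginal k y = (√(2 * Real.pi * D.φ) ^ n)⁻¹ * ((√(1 + D.τ))⁻¹ ^ k.card *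
      (Real.exp (-‖y‖ ^ 2 / (2 * D.φ)) * Real.exp (D.τ / (1 + D.τ) *
        ‖(D.colSpan k).starProjection y‖ ^ 2 / (2 * D.φ)))) := by
  have hτ := D.τ_pos
  have hφ := D.φ_pos
  have h1 : D.marginal k y = ∫ v, (√(2 * Real.pi * D.φ) ^ n)⁻¹ *
      Real.exp (-‖y - v‖ ^ 2 / (2 * D.φ)) ∂((D.coefPrior k).map (D.colMap k)) := by
    rw [integral_map (by fun_prop) (Measurable.aestronglyMeasurable (by fun_prop))]
    rfl
  rw [h1, map_colMap_coefPrior hk, integral_map (by fun_prop)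
    (Measurable.aestronglyMeasurable (by fun_prop)), integral_const_mul]
  congr 1
  have h2 : ∀ z : EuclideanSpace ℝ (Fin n),
      Real.exp (-‖y - (√(D.τ * D.φ) • (D.colSpan k).starProjection) z‖ ^ 2 / (2 * D.φ)) =
      Real.exp (-‖y‖ ^ 2 / (2 * D.φ)) *
        Real.exp (-D.τ / 2 * ‖(D.colSpan k).starProjection z‖ ^ 2 +
          inner ℝ ((√(D.τ * D.φ) / D.φ) • y) ((D.colSpan k).starProjection z)) := by
    intro z
    rw [← Real.exp_add, smul_apply, norm_sub_sq_real, norm_smul,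
      real_inner_smul_right, real_inner_smul_left, mul_pow, Real.norm_eq_abs, sq_abs,
      Real.sq_sqrt (by positivity)]
    congr 1
    field_simp
    ring
  simp_rw [h2]
  rw [integral_const_mul, integral_exp_quadratic_proj_stdGaussian _ (by linarith),
    finrank_colSpan hk, map_smul, norm_smul, mul_pow, Real.norm_eq_abs, sq_abs, div_pow,
    Real.sq_sqrt (by positivity)]
  -- The likelihood supplies the quadratic coefficient `-τ / 2`; this is the origin of the factor `1
  -- + τ`.
  rw [show 1 - 2 * (-D.τ / 2) = 1 + D.τ by ring, mul_left_comm]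
  congr 3
  field_simp

theorem truth_eq_map :
    D.truth = (stdGaussian (EuclideanSpace ℝ (Fin n))).map
      (fun z => WithLp.toLp 2 D.trueMean + √D.φ • z) := by
  have hφ := D.φ_pos
  have hS : (D.φ • (1 : Matrix (Fin n) (Fin n) ℝ)).PosSemidef := Matrix.PosSemidef.one.smul hφ.le
  have : (fun z : EuclideanSpace ℝ (Fin n) => WithLp.toLp 2 D.trueMean + √D.φ • z) =
    (fun z => WithLp.toLp 2 D.trueMean + z) ∘
      (√D.φ • ContinuousLinearMap.id ℝ (EuclideanSpace ℝ (Fin n))) := by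
    ext1 z
    simp
  rw [truth, this, ← Measure.map_map (by fun_prop) (by fun_prop)]
  apply Measure.ext_of_charFun
  ext y
  rw [charFun_multivariateGaussian hS, charFun_map_const_add, charFun_map_continuousLinearMap,
    charFun_stdGaussian, map_smulₛₗ, ContinuousLinearMap.adjoint_id, smul_apply,
    ContinuousLinearMap.id_apply, ← Complex.exp_add, Matrix.smul_mulVec, Matrix.one_mulVec,
    dotProduct_smul, ← Complex.ofReal_pow, norm_smul, mul_pow, Real.norm_eq_abs]
  have h : y.ofLp ⬝ᵥ y.ofLp = ‖y‖ ^ 2 := by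
    rw [← real_inner_self_eq_norm_sq, EuclideanSpace.inner_eq_star_dotProduct, star_trivial]
  rw [h, real_inner_comm]
  congr 1
  simp [Real.sq_sqrt hφ.le]
  ring

end ZellnerRegression

/-! ### Inequalities for differences of squared projections. -/

section Projections

/-- Equivalent to `0 ≤ ‖x + 2y‖ ^ 2`. -/
theorem half_norm_sq_sub_le_norm_add_sq {E : Type*} [NormedAddCommGroup E]
    [InnerProductSpace ℝ E] (x y : E) :
    ‖x‖ ^ 2 / 2 - ‖y‖ ^ 2 ≤ ‖x + y‖ ^ 2 := by
  have h1 := norm_add_sq_real x y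
  have h2 := norm_add_sq_real x ((2 : ℝ) • y)
  rw [real_inner_smul_right, norm_smul, Real.norm_eq_abs, mul_pow, sq_abs] at h2
  linarith [sq_nonneg ‖x + (2 : ℝ) • y‖]

variable {E : Type*} [NormedAddCommGroup E] [InnerProductSpace ℝ E] [FiniteDimensional ℝ E]

theorem norm_sub_starProjection_sq (K : Submodule ℝ E) (x : E) :
    ‖x - K.starProjection x‖ ^ 2 = ‖x‖ ^ 2 - ‖K.starProjection x‖ ^ 2 := by
  have h := K.inner_starProjection_left_eq_right x (K.starProjection x)
  rw [Submodule.starProjection_eq_self_iff.2 (K.starProjection_apply_mem x),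
    real_inner_self_eq_norm_sq] at h
  rw [norm_sub_sq_real, ← h]
  ring

theorem norm_sub_starProjection_le (K : Submodule ℝ E) (x : E) :
    ‖x - K.starProjection x‖ ^ 2 ≤ ‖x‖ ^ 2 := by
  rw [norm_sub_starProjection_sq]
  linarith [sq_nonneg ‖K.starProjection x‖]

theorem norm_starProjection_sq_eq_add {S M : Submodule ℝ E} (h : S ≤ M) (x : E) :
    ‖M.starProjection x‖ ^ 2 = ‖S.starProjection x‖ ^ 2 + ‖(M ⊓ Sᗮ).starProjection x‖ ^ 2 := by
  have hV : M.starProjection x - S.starProjection x = (M ⊓ Sᗮ).starProjection x := by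
    refine (Submodule.eq_starProjection_of_mem_of_inner_eq_zero (Submodule.mem_inf.2
      ⟨M.sub_mem (M.starProjection_apply_mem x) (h (S.starProjection_apply_mem x)), ?_⟩)
      fun v hv => ?_).symm
    · have h1 := Submodule.orthogonal_le h (M.sub_starProjection_mem_orthogonal x)
      have h2 := S.sub_starProjection_mem_orthogonal x
      convert Sᗮ.sub_mem h2 h1 using 1
      abel
    · rw [show x - (M.starProjection x - S.starProjection x) =
        (x - M.starProjection x) + S.starProjection x by abel, inner_add_left,
        M.starProjection_inner_eq_zero x v hv.1, hv.2 _ (S.starProjection_apply_mem x), add_zero]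
  have ho : inner ℝ (S.starProjection x) ((M ⊓ Sᗮ).starProjection x) = 0 :=
    ((M ⊓ Sᗮ).starProjection_apply_mem x).2 _ (S.starProjection_apply_mem x)
  have := norm_add_sq_real (S.starProjection x) ((M ⊓ Sᗮ).starProjection x)
  rw [ho, ← hV, add_sub_cancel] at this
  rw [this, ← hV]
  ring

theorem starProjection_starProjection_of_le {S U : Submodule ℝ E} (h : S ≤ U) (x : E) :
    S.starProjection (U.starProjection x) = S.starProjection x :=
  congr($(Submodule.starProjection_comp_starProjection_of_le h) x)

/-- Both projections factor through `U`, so `z` may be replaced by its projection `w`. In terms of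
residuals, the one for `S` only sees `w`, since `μ ∈ S`, and costs at most `‖w‖ ^ 2`. The one for
`M` keeps half of the squared residual of `μ`, up to another `‖w‖ ^ 2`. -/
theorem norm_starProjection_sq_sub_le {S M U : Submodule ℝ E} (hS : S ≤ U) (hM : M ≤ U)
    {μ : E} (hμ : μ ∈ S) (z : E) :
    ‖M.starProjection (μ + z)‖ ^ 2 - ‖S.starProjection (μ + z)‖ ^ 2 ≤
      2 * ‖U.starProjection z‖ ^ 2 - ‖μ - M.starProjection μ‖ ^ 2 / 2 := by
  rw [← starProjection_starProjection_of_le hS, ← starProjection_starProjection_of_le hM,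
    map_add U.starProjection, Submodule.starProjection_eq_self_iff.2 (hS hμ)]
  set w := U.starProjection z
  have h1 := norm_sub_starProjection_sq M (μ + w)
  have h2 := norm_sub_starProjection_sq S (μ + w)
  have h3 := half_norm_sq_sub_le_norm_add_sq (μ - M.starProjection μ) (w - M.starProjection w)
  have h4 := norm_sub_starProjection_le M w
  have h5 := norm_sub_starProjection_le S w
  rw [show μ - M.starProjection μ + (w - M.starProjection w) =
    μ + w - M.starProjection (μ + w) by rw [map_add]; abel] at h3
  rw [show μ + w - S.starProjection (μ + w) = w - S.starProjection w by
    rw [map_add, Submodule.starProjection_eq_self_iff.2 hμ]; abel] at h2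
  linarith

end Projections

/-! ### Non-asymptotic bounds on the mean posterior probability. -/

namespace ZellnerRegression

variable {n : ℕ} {D : ZellnerRegression n} {m : Finset (Fin D.p)}

theorem t_mem_models : D.t ∈ D.models := by simp [models, D.t_card_le]

theorem mem_models_iff : m ∈ D.models ↔ m.card ≤ D.pbar := by simp [models]

theorem trueMean_mem : WithLp.toLp 2 D.trueMean ∈ D.colSpan D.t :=
  D.colMap_mem D.t (WithLp.toLp 2 D.θstar)

theorem priorRatio_pos {a b : ℕ} (ha : a ≤ D.pbar) (hb : b ≤ D.pbar) : 0 < D.priorRatio a b :=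
  div_pos (D.modelPrior_pos a ha) (D.modelPrior_pos b hb)

theorem ratio_pos (hm : m ∈ D.models) : 0 < D.ratio m :=
  priorRatio_pos (mem_models_iff.1 hm) D.t_card_le

theorem g_eq (m : Finset (Fin D.p)) : D.g m = (1 + D.τ) ^ (D.dimDiff m / 2) / D.ratio m := by
  rw [g, ratio, priorRatio, priorRatio, div_div_eq_mul_div, mul_div_assoc]

theorem g_pos (hm : m ∈ D.models) : 0 < D.g m := by
  have := D.τ_pos
  rw [g_eq]
  exact div_pos (by positivity) (ratio_pos hm)

theorem log_g (hm : m ∈ D.models) :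
    Real.log (D.g m) = D.dimDiff m / 2 * Real.log (1 + D.τ) - Real.log (D.ratio m) := by
  have := D.τ_pos
  rw [g_eq, Real.log_div (by positivity) (ratio_pos hm).ne', Real.log_rpow (by positivity)]

theorem marginal_pos {k : Finset (Fin D.p)} (hk : k ∈ D.models) (y : EuclideanSpace ℝ (Fin n)) :
    0 < D.marginal k y := by
  have h1 := D.τ_pos
  have h2 := D.φ_pos
  rw [marginal_eq (mem_models_iff.1 hk)]
  positivity

theorem bayesFactor_mul_priorRatio (hm : m ∈ D.models) (y : EuclideanSpace ℝ (Fin n)) :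
    D.bayesFactor D.t m y * D.priorRatio D.t.card m.card =
      D.g m * Real.exp (-(D.τ / (1 + D.τ) * (‖(D.colSpan m).starProjection y‖ ^ 2 -
        ‖(D.colSpan D.t).starProjection y‖ ^ 2) / (2 * D.φ))) := by
  have hτ := D.τ_pos
  have hφ := D.φ_pos
  have hpow : (1 + D.τ) ^ (D.dimDiff m / 2) =
      (√(1 + D.τ))⁻¹ ^ D.t.card / (√(1 + D.τ))⁻¹ ^ m.card := by
    rw [dimDiff, sub_div, Real.rpow_sub (by positivity), inv_pow, inv_pow, Real.sqrt_eq_rpow,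
      ← Real.rpow_mul_natCast (by positivity), ← Real.rpow_mul_natCast (by positivity),
      inv_div_inv, one_div_mul_eq_div, one_div_mul_eq_div]
  have hexp : Real.exp (-(D.τ / (1 + D.τ) * (‖(D.colSpan m).starProjection y‖ ^ 2 -
        ‖(D.colSpan D.t).starProjection y‖ ^ 2) / (2 * D.φ))) =
      Real.exp (D.τ / (1 + D.τ) * ‖(D.colSpan D.t).starProjection y‖ ^ 2 / (2 * D.φ)) /
      Real.exp (D.τ / (1 + D.τ) * ‖(D.colSpan m).starProjection y‖ ^ 2 / (2 * D.φ)) := by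
    rw [← Real.exp_sub]
    congr 1
    ring
  rw [bayesFactor, marginal_eq D.t_card_le, marginal_eq (mem_models_iff.1 hm), g, hpow, hexp]
  have h1 : √(2 * Real.pi * D.φ) ^ n ≠ 0 := by positivity
  have h2 : √(1 + D.τ) ≠ 0 := by positivity
  field_simp

theorem sum_bayesFactor_nonneg (hm : m ∈ D.models) (s : Finset (Finset (Fin D.p)))
    (hs : s ⊆ D.models) (y : EuclideanSpace ℝ (Fin n)) :
    0 ≤ ∑ l ∈ s, D.bayesFactor l m y * D.priorRatio l.card m.card :=
  Finset.sum_nonneg fun _ hl => mul_nonneg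
    (div_pos (marginal_pos (hs hl) y) (marginal_pos hm y)).le
    (priorRatio_pos (mem_models_iff.1 (hs hl)) (mem_models_iff.1 hm)).le

theorem posterior_nonneg (hm : m ∈ D.models) (y : EuclideanSpace ℝ (Fin n)) :
    0 ≤ D.posterior m y :=
  inv_nonneg.2 (add_nonneg zero_le_one
    (sum_bayesFactor_nonneg hm _ (Finset.erase_subset _ _) y))

/-- All terms of the sum are nonnegative, so only `l = D.t` is kept; then `B ^ σ ≤ (1 + B) ^ σ ≤ 1 +
B`. An exponent `σ < 1` is what makes the Gaussian moments finite later. -/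
theorem posterior_le (hm : m ∈ D.models) (hne : D.t ≠ m) {σ : ℝ} (h0 : 0 ≤ σ) (h1 : σ ≤ 1)
    (y : EuclideanSpace ℝ (Fin n)) :
    D.posterior m y ≤ D.g m ^ (-σ) *
      Real.exp (σ * (D.τ / (1 + D.τ) * (‖(D.colSpan m).starProjection y‖ ^ 2 -
        ‖(D.colSpan D.t).starProjection y‖ ^ 2) / (2 * D.φ))) := by
  set q := D.τ / (1 + D.τ) * (‖(D.colSpan m).starProjection y‖ ^ 2 -
        ‖(D.colSpan D.t).starProjection y‖ ^ 2) / (2 * D.φ) with hq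
  set B := D.g m * Real.exp (-q) with hB
  have hBpos : 0 < B := mul_pos (g_pos hm) (Real.exp_pos _)
  have hsum : B ≤ ∑ l ∈ D.models.erase m, D.bayesFactor l m y * D.priorRatio l.card m.card := by
    rw [hB, hq, ← bayesFactor_mul_priorRatio hm y]
    refine Finset.single_le_sum
      (f := fun l => D.bayesFactor l m y * D.priorRatio l.card m.card) (fun l hl => ?_)
      (Finset.mem_erase.2 ⟨hne, t_mem_models⟩)
    have := Finset.mem_of_mem_erase hl
    simpa using sum_bayesFactor_nonneg hm {l} (by simpa using this) y
  have hrhs : D.g m ^ (-σ) * Real.exp (σ * q) = (B ^ σ)⁻¹ := by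
    rw [← Real.rpow_neg hBpos.le, hB, Real.mul_rpow (g_pos hm).le (Real.exp_pos _).le,
      ← Real.exp_mul]
    congr 2
    ring
  rw [hrhs]
  refine inv_anti₀ (by positivity) ?_
  calc B ^ σ ≤ (1 + B) ^ σ := Real.rpow_le_rpow hBpos.le (by linarith) h0
    _ ≤ (1 + B) ^ (1 : ℝ) := Real.rpow_le_rpow_of_exponent_le (by linarith) h1
    _ ≤ _ := by rw [Real.rpow_one]; linarith

theorem meanPosterior_nonneg (hm : m ∈ D.models) : 0 ≤ D.meanPosterior m :=
  integral_nonneg fun y => posterior_nonneg hm y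

theorem meanPosterior_le (hm : m ∈ D.models) (hne : D.t ≠ m) {σ b κ : ℝ} (h0 : 0 ≤ σ)
    (h1 : σ ≤ 1) (hb : σ * b < 1 / 2) (K : Submodule ℝ (EuclideanSpace ℝ (Fin n)))
    (hle : ∀ z, D.τ / (1 + D.τ) * (‖(D.colSpan m).starProjection
        (WithLp.toLp 2 D.trueMean + √D.φ • z)‖ ^ 2 -
        ‖(D.colSpan D.t).starProjection (WithLp.toLp 2 D.trueMean + √D.φ • z)‖ ^ 2) / (2 * D.φ)
      ≤ κ + b * ‖K.starProjection z‖ ^ 2) :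
    D.meanPosterior m ≤ D.g m ^ (-σ) * Real.exp (σ * κ) *
      (√(1 - 2 * (σ * b)))⁻¹ ^ Module.finrank ℝ K := by
  set F : EuclideanSpace ℝ (Fin n) → ℝ := fun y => Real.exp (σ * (D.τ / (1 + D.τ) *
    (‖(D.colSpan m).starProjection y‖ ^ 2 -
      ‖(D.colSpan D.t).starProjection y‖ ^ 2) / (2 * D.φ))) with hF
  have hFc : Continuous F := by fun_prop
  have hFle : ∀ z, F (WithLp.toLp 2 D.trueMean + √D.φ • z) ≤
      Real.exp (σ * κ) * Real.exp (σ * b * ‖K.starProjection z‖ ^ 2) := by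
    intro z
    rw [hF, ← Real.exp_add]
    refine Real.exp_le_exp.2 ((mul_le_mul_of_nonneg_left (hle z) h0).trans_eq ?_)
    ring
  have hint := (integrable_exp_sq_proj_stdGaussian K hb).const_mul (Real.exp (σ * κ))
  have hFint : Integrable (fun z => F (WithLp.toLp 2 D.trueMean + √D.φ • z))
      (stdGaussian (EuclideanSpace ℝ (Fin n))) := by
    refine hint.mono' (Continuous.aestronglyMeasurable (by fun_prop)) (ae_of_all _ fun z => ?_)
    rw [Real.norm_of_nonneg (Real.exp_pos _).le]
    exact hFle z
  calc D.meanPosterior m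
      ≤ ∫ y, D.g m ^ (-σ) * F y ∂D.truth := by
        refine integral_mono_of_nonneg (ae_of_all _ fun y => posterior_nonneg hm y) ?_
          (ae_of_all _ fun y => posterior_le hm hne h0 h1 y)
        refine Integrable.const_mul ?_ _
        rw [truth_eq_map]
        exact (integrable_map_measure hFc.aestronglyMeasurable (by fun_prop)).2 hFint
    _ = D.g m ^ (-σ) * ∫ z, F (WithLp.toLp 2 D.trueMean + √D.φ • z)
          ∂(stdGaussian (EuclideanSpace ℝ (Fin n))) := by
        rw [integral_const_mul, truth_eq_map, integral_map (by fun_prop)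
          hFc.aestronglyMeasurable]
    _ ≤ D.g m ^ (-σ) * (Real.exp (σ * κ) * (√(1 - 2 * (σ * b)))⁻¹ ^ Module.finrank ℝ K) := by
        refine mul_le_mul_of_nonneg_left ?_ (Real.rpow_nonneg (g_pos hm).le _)
        rw [← integral_exp_sq_proj_stdGaussian K hb, ← integral_const_mul]
        exact integral_mono hFint hint hFle
    _ = _ := by ring

theorem τ_div_le_one : D.τ / (1 + D.τ) ≤ 1 := by
  have := D.τ_pos
  rw [div_le_one (by positivity)]
  linarith

theorem meanPosterior_le_of_isSpurious (hm : D.IsSpurious m) {σ : ℝ} (h0 : 0 ≤ σ)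
    (h1 : σ < 1) :
    D.meanPosterior m ≤ D.g m ^ (-σ) * (1 - σ) ^ (-(D.dimDiff m / 2)) := by
  have hφ := D.φ_pos
  set V := D.colSpan m ⊓ (D.colSpan D.t)ᗮ
  have hsub := colSpan_mono hm.2.subset
  have hfin : (Module.finrank ℝ V : ℝ) = D.dimDiff m := by
    have h := Submodule.finrank_add_inf_finrank_orthogonal hsub
    rw [finrank_colSpan D.t_card_le, finrank_colSpan (mem_models_iff.1 hm.1), inf_comm] at h
    rw [dimDiff, ← h]
    push_cast
    ring
  have key := meanPosterior_le hm.1 hm.2.ne h0 h1.le (b := 1 / 2) (κ := 0) (by linarith) V ?_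
  · rw [mul_zero, Real.exp_zero, mul_one, show 1 - 2 * (σ * (1 / 2)) = 1 - σ by ring] at key
    refine key.trans_eq ?_
    rw [← hfin, Real.sqrt_eq_rpow, ← Real.rpow_neg (by linarith),
      ← Real.rpow_mul_natCast (by linarith)]
    congr 2
    ring
  · intro z
    -- The true mean lies in the span of `D.t`, to which `V` is orthogonal, so only noise remains.
    have hV : V.starProjection (WithLp.toLp 2 D.trueMean) = 0 := by
      rw [Submodule.starProjection_apply_eq_zero_iff]
      intro v hv
      rw [real_inner_comm]
      exact hv.2 _ trueMean_mem
    rw [norm_starProjection_sq_eq_add hsub, add_sub_cancel_left, map_add, hV, zero_add, map_smul,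
      norm_smul, mul_pow, Real.norm_eq_abs, sq_abs, Real.sq_sqrt hφ.le, zero_add]
    calc D.τ / (1 + D.τ) * (D.φ * ‖V.starProjection z‖ ^ 2) / (2 * D.φ)
        = D.τ / (1 + D.τ) * (1 / 2 * ‖V.starProjection z‖ ^ 2) := by field_simp
      _ ≤ 1 * (1 / 2 * ‖V.starProjection z‖ ^ 2) :=
        mul_le_mul_of_nonneg_right τ_div_le_one (by positivity)
      _ = _ := one_mul _

theorem noncentrality_eq (hm : m ∈ D.models) :
    D.noncentrality m = ‖WithLp.toLp 2 D.trueMean -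
      (D.colSpan m).starProjection (WithLp.toLp 2 D.trueMean)‖ ^ 2 / D.φ := by
  have h := (D.colSpan m).inner_starProjection_left_eq_right (WithLp.toLp 2 D.trueMean)
    ((D.colSpan m).starProjection (WithLp.toLp 2 D.trueMean))
  rw [Submodule.starProjection_eq_self_iff.2 (Submodule.starProjection_apply_mem _ _),
    real_inner_self_eq_norm_sq, real_inner_comm] at h
  rw [norm_sub_starProjection_sq, noncentrality, Matrix.sub_mulVec, Matrix.one_mulVec,
    dotProduct_sub, h, ← real_inner_self_eq_norm_sq, starProjection_colSpan (mem_models_iff.1 hm)]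
  simp only [EuclideanSpace.inner_eq_star_dotProduct, star_trivial]

theorem noncentrality_nonneg (hm : m ∈ D.models) : 0 ≤ D.noncentrality m := by
  have hφ := D.φ_pos
  rw [noncentrality_eq hm]
  positivity

theorem meanPosterior_le_of_isNonSpurious (hm : D.IsNonSpurious m) :
    D.meanPosterior m ≤ D.g m ^ (-(1 / 4 : ℝ)) *
      Real.exp (-(D.τ / (1 + D.τ) * D.noncentrality m / 16)) * 2 ^ (D.t ∪ m).card := by
  have hφ := D.φ_pos
  have hne : D.t ≠ m := fun h => hm.2 h.subset
  have key := meanPosterior_le hm.1 hne (σ := 1 / 4) (b := 1)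
    (κ := -(D.τ / (1 + D.τ) * D.noncentrality m / 4)) (by norm_num) (by norm_num) (by norm_num)
    (D.colSpan (D.t ∪ m)) ?_
  · refine key.trans ?_
    rw [show (1 / 4 : ℝ) * -(D.τ / (1 + D.τ) * D.noncentrality m / 4) =
      -(D.τ / (1 + D.τ) * D.noncentrality m / 16) by ring]
    have hg := (g_pos hm.1).le
    refine mul_le_mul_of_nonneg_left ?_ (by positivity)
    -- The exact value is `√2`; the cruder 2 is harmless, as only the order of the exponent matters.
    have h2 : (√(1 - 2 * (1 / 4 * 1) : ℝ))⁻¹ ≤ 2 := by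
      refine inv_le_of_inv_le₀ (by norm_num) (Real.le_sqrt_of_sq_le (by norm_num))
    calc _ ≤ (2 : ℝ) ^ Module.finrank ℝ (D.colSpan (D.t ∪ m)) :=
          pow_le_pow_left₀ (by positivity) h2 _
      _ ≤ _ := pow_le_pow_right₀ (by norm_num) (finrank_colSpan_le _)
  · intro z
    have h := norm_starProjection_sq_sub_le (colSpan_mono (D := D) (Finset.subset_union_left))
      (colSpan_mono (D := D) (Finset.subset_union_right (s₁ := D.t) (s₂ := m)))
      (trueMean_mem (D := D)) (√D.φ • z)
    rw [map_smul _ (√D.φ), norm_smul, mul_pow, Real.norm_eq_abs, sq_abs, Real.sq_sqrt hφ.le,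
      ← mul_div_cancel₀ (‖_ - (D.colSpan m).starProjection _‖ ^ 2) hφ.ne',
      ← noncentrality_eq hm.1] at h
    set Q := ‖(D.colSpan (D.t ∪ m)).starProjection z‖ ^ 2 with hQ
    have hQ0 : 0 ≤ Q := by positivity
    calc _ ≤ D.τ / (1 + D.τ) * (2 * (D.φ * Q) - D.φ * D.noncentrality m / 2) / (2 * D.φ) := by
          have := D.τ_pos
          gcongr
      _ = -(D.τ / (1 + D.τ) * D.noncentrality m / 4) + D.τ / (1 + D.τ) * Q := by
          field_simp
          ring
      _ ≤ _ := by
          have := mul_le_mul_of_nonneg_right (τ_div_le_one (D := D)) hQ0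
          linarith

end ZellnerRegression

/-! ### Asymptotic rates. -/

theorem sub_mul_log_le_one {x : ℝ} (hx : 0 < x) : x - x * Real.log x ≤ 1 := by
  have h := mul_le_mul_of_nonneg_left (Real.one_sub_inv_le_log_of_pos hx) hx.le
  rw [mul_sub, mul_inv_cancel₀ hx.ne'] at h
  linarith

theorem eventually_rpow_le_mul {β ε : ℝ} (hβ : β < 1) (hε : 0 < ε) :
    ∀ᶠ x : ℝ in atTop, x ^ β ≤ ε * x := by
  filter_upwards [(tendsto_rpow_atTop (sub_pos.2 hβ)).eventually_ge_atTop ε⁻¹,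
    eventually_gt_atTop 0] with x h hx
  rw [Real.rpow_sub hx, Real.rpow_one, le_div_iff₀ (by positivity), inv_mul_le_iff₀ hε] at h
  exact h

namespace ZellnerRegression

section Single

variable {n : ℕ} {D : ZellnerRegression n} {m : Finset (Fin D.p)}

theorem IsSpurious.one_le_dimDiff (hm : D.IsSpurious m) : 1 ≤ D.dimDiff m := by
  have h : D.t.card + 1 ≤ m.card := Finset.card_lt_card hm.2
  have : ((D.t.card + 1 : ℕ) : ℝ) ≤ m.card := by exact_mod_cast h
  push_cast at this
  rw [dimDiff]
  linarith

theorem IsNonSpurious.one_le_card_union (hm : D.IsNonSpurious m) :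
    (1 : ℝ) ≤ (D.t ∪ m).card := by
  obtain ⟨i, hi, -⟩ := Finset.not_subset.1 hm.2
  exact_mod_cast Finset.card_pos.2 ⟨i, Finset.mem_union_left _ hi⟩

theorem g_rpow_eq_exp (hm : m ∈ D.models) (σ : ℝ) :
    D.g m ^ σ = Real.exp (σ * Real.log (D.g m)) := by
  rw [Real.rpow_def_of_pos (g_pos hm), mul_comm]

theorem logRate_eq_exp (hm : m ∈ D.models) (hL : 0 < Real.log (D.g m)) :
    D.logRate m =
      Real.exp (D.dimDiff m / 2 * Real.log (Real.log (D.g m)) - Real.log (D.g m)) := by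
  rw [logRate, Real.exp_sub, Real.exp_log (g_pos hm), Real.rpow_def_of_pos hL, mul_comm]

theorem exp_neg_log_g_le_powerRate (hm : D.IsSpurious m) {α : ℝ} (hα : 0 < α) :
    Real.exp (-α * Real.log (D.g m)) ≤ D.powerRate α m := by
  have hτ := D.τ_pos
  have hr := ratio_pos hm.1
  have hd := hm.one_le_dimDiff
  rw [← g_rpow_eq_exp hm.1, g_eq, Real.rpow_neg (by positivity),
    Real.div_rpow (by positivity) hr.le, inv_div, ← Real.rpow_mul (by positivity), powerRate]
  rw [show D.dimDiff m / 2 * α = α * D.dimDiff m / 2 by ring]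
  gcongr
  linarith

theorem meanPosterior_le_logRate (hm : D.IsSpurious m)
    (hL : D.dimDiff m ≤ Real.log (D.g m)) :
    D.meanPosterior m ≤ Real.exp 1 * D.logRate m := by
  have hd := hm.one_le_dimDiff
  set d := D.dimDiff m with hd_def
  set L := Real.log (D.g m) with hL_def
  have hL0 : 0 < L := by linarith
  have hq : d / (2 * L) ≤ 1 := by
    rw [div_le_one (by positivity)]
    linarith
  have hq0 : 0 < d / (2 * L) := by positivity
  -- This `σ` minimises the bound.
  refine (meanPosterior_le_of_isSpurious hm (σ := 1 - d / (2 * L)) (by linarith)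
    (by linarith)).trans ?_
  rw [g_rpow_eq_exp hm.1, logRate_eq_exp hm.1 hL0, sub_sub_cancel, Real.rpow_def_of_pos hq0,
    ← Real.exp_add, ← Real.exp_add, ← hL_def, ← hd_def]
  refine Real.exp_le_exp.2 ?_
  -- What is left beyond the rate is `exp (d/2 - (d/2) log (d/2))`; bounding it by `e` makes the
  -- constant uniform in `d`.
  have h1 := sub_mul_log_le_one (x := d / 2) (by linarith)
  have h2 : Real.log (d / (2 * L)) = Real.log (d / 2) - Real.log L := by
    rw [← Real.log_div (by positivity) (by positivity), div_div]
  have h3 : -(1 - d / (2 * L)) * L = d / 2 - L := by field_simp; ring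
  rw [h2, h3]
  linarith

end Single

variable {D : ∀ n, ZellnerRegression n} {m : ∀ n, Finset (Fin (D n).p)}

/-- By (C1), `log g` is at least `(1 - β₂) (d / 2) log τ`, and `log τ` diverges. -/
theorem eventually_mul_dimDiff_le_log_g (hm : ∀ᶠ n in atTop, (D n).IsSpurious (m n))
    (hC1 : CondC1 D m) (K : ℝ) :
    ∀ᶠ n in atTop, K * (D n).dimDiff (m n) ≤ Real.log ((D n).g (m n)) := by
  obtain ⟨hτ, β, ⟨hβ0, hβ1⟩, hr⟩ := hC1
  filter_upwards [hm, isLittleO_iff.1 hr one_pos,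
    (Real.tendsto_log_atTop.comp hτ).eventually_ge_atTop (2 * K / (1 - β))] with n hm hr hlog
  have hτ0 := (D n).τ_pos
  have hd := hm.one_le_dimDiff
  have hr0 := ratio_pos hm.1
  rw [one_mul, Real.norm_of_nonneg hr0.le, Real.norm_of_nonneg (by positivity)] at hr
  have h1 := Real.log_le_log hr0 hr
  rw [Real.log_rpow hτ0] at h1
  have h2 : Real.log (D n).τ ≤ Real.log (1 + (D n).τ) := Real.log_le_log hτ0 (by linarith)
  rw [Function.comp_apply, div_le_iff₀ (by linarith)] at hlog
  rw [log_g hm.1]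
  have h3 := mul_le_mul_of_nonneg_left h2 (by linarith : 0 ≤ (D n).dimDiff (m n) / 2)
  have h4 := mul_le_mul_of_nonneg_left hlog (by linarith : 0 ≤ (D n).dimDiff (m n) / 2)
  linarith

theorem eventually_le_log_g (hm : ∀ᶠ n in atTop, (D n).IsSpurious (m n))
    (hC1 : CondC1 D m) (K : ℝ) :
    ∀ᶠ n in atTop, K ≤ Real.log ((D n).g (m n)) := by
  filter_upwards [hm, eventually_mul_dimDiff_le_log_g hm hC1 |K|] with n hm h
  have := mul_le_mul_of_nonneg_left hm.one_le_dimDiff (abs_nonneg K)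
  linarith [le_abs_self K]

theorem meanPosterior_isBigO_logRate (hm : ∀ᶠ n in atTop, (D n).IsSpurious (m n))
    (hC1 : CondC1 D m) :
    (fun n => (D n).meanPosterior (m n)) =O[atTop] fun n => (D n).logRate (m n) := by
  refine IsBigO.of_bound (Real.exp 1) ?_
  filter_upwards [hm, eventually_mul_dimDiff_le_log_g hm hC1 1] with n hm h
  rw [one_mul] at h
  have h0 := meanPosterior_nonneg hm.1
  have h1 := meanPosterior_le_logRate hm h
  rw [Real.norm_of_nonneg h0]
  exact h1.trans (mul_le_mul_of_nonneg_left (le_abs_self _) (Real.exp_pos 1).le)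

/-- A sequence of nonnegative numbers is of smaller order than `powerRate α` as soon as its terms
are eventually at most `c * exp (-α * log g)`, for every `c > 0`. -/
theorem isLittleO_powerRate {f : ℕ → ℝ} {α : ℝ} (hα : 0 < α)
    (hm : ∀ᶠ n in atTop, (D n).IsSpurious (m n)) (h0 : ∀ᶠ n in atTop, 0 ≤ f n)
    (hf : ∀ c : ℝ, ∀ᶠ n in atTop, f n ≤ Real.exp (c - α * Real.log ((D n).g (m n)))) :
    f =o[atTop] fun n => (D n).powerRate α (m n) := by
  refine isLittleO_iff.2 fun c hc => ?_
  filter_upwards [hm, h0, hf (Real.log c)] with n hm h0 hf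
  rw [Real.norm_of_nonneg h0]
  rw [sub_eq_add_neg, Real.exp_add, Real.exp_log hc, ← neg_mul] at hf
  exact hf.trans (mul_le_mul_of_nonneg_left
    ((exp_neg_log_g_le_powerRate hm hα).trans (le_abs_self _)) hc.le)

theorem meanPosterior_isLittleO_powerRate (hm : ∀ᶠ n in atTop, (D n).IsSpurious (m n))
    (hC1 : CondC1 D m) {α : ℝ} (hα : α ∈ Set.Ioo (0 : ℝ) 1) :
    (fun n => (D n).meanPosterior (m n)) =o[atTop] fun n => (D n).powerRate α (m n) := by
  obtain ⟨hα0, hα1⟩ := hα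
  refine isLittleO_powerRate hα0 hm (hm.mono fun n hm => meanPosterior_nonneg hm.1) fun c => ?_
  set C := -Real.log (1 - (1 + α) / 2) / 2 with hC
  filter_upwards [hm,
    eventually_mul_dimDiff_le_log_g hm hC1 ((C + |c|) / ((1 - α) / 2))] with n hm h
  -- The surplus `((1 - α) / 2) log g` over the target exponent `α` absorbs both `exp (C d)` and the
  -- constant `c`.
  refine (meanPosterior_le_of_isSpurious hm (σ := (1 + α) / 2) (by linarith)
    (by linarith)).trans ?_
  rw [g_rpow_eq_exp hm.1, Real.rpow_def_of_pos (by linarith), ← Real.exp_add]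
  refine Real.exp_le_exp.2 ?_
  rw [div_mul_eq_mul_div, div_le_iff₀ (by linarith)] at h
  have hd := mul_le_mul_of_nonneg_left hm.one_le_dimDiff (abs_nonneg c)
  have h1 : Real.log (1 - (1 + α) / 2) * -((D n).dimDiff (m n) / 2) =
      C * (D n).dimDiff (m n) := by rw [hC]; ring
  rw [h1]
  linarith [neg_abs_le c]

theorem logRate_isLittleO_powerRate (hm : ∀ᶠ n in atTop, (D n).IsSpurious (m n))
    (hC1 : CondC1 D m)
    (hlog : (fun n => (D n).dimDiff (m n) * Real.log (Real.log ((D n).g (m n))))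
      =o[atTop] fun n => Real.log ((D n).g (m n)))
    {α : ℝ} (hα : α ∈ Set.Ioo (0 : ℝ) 1) :
    (fun n => (D n).logRate (m n)) =o[atTop] fun n => (D n).powerRate α (m n) := by
  obtain ⟨hα0, hα1⟩ := hα
  have hL := eventually_le_log_g hm hC1
  refine isLittleO_powerRate hα0 hm ?_ fun c => ?_
  · filter_upwards [hm, hL 1] with n hm h
    rw [logRate_eq_exp hm.1 (by linarith)]
    positivity
  · filter_upwards [hm, hL 1, hL (-c / ((1 - α) / 2)),
      isLittleO_iff.1 hlog (sub_pos.2 hα1)] with n hm h1 hc h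
    rw [logRate_eq_exp hm.1 (by linarith)]
    refine Real.exp_le_exp.2 ?_
    rw [Real.norm_of_nonneg (by linarith : 0 ≤ Real.log ((D n).g (m n)))] at h
    have := (le_abs_self _).trans h
    rw [div_le_iff₀ (by linarith)] at hc
    linarith

/-- A model not containing `t` forces `t` to be nonempty, so `p_q ≥ 1` and (B2) drives `λ ^ β₁` to
infinity. -/
theorem tendsto_noncentrality (hm : ∀ᶠ n in atTop, (D n).IsNonSpurious (m n))
    (hB2 : CondB2 D m) : Tendsto (fun n => (D n).noncentrality (m n)) atTop atTop := by
  obtain ⟨β, ⟨hβ, -⟩, h⟩ := hB2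
  refine tendsto_atTop.2 fun K => ?_
  filter_upwards [hm, isLittleO_iff.1 h (c := ((|K| + 1) ^ β)⁻¹) (by positivity)] with n hm h
  by_contra! hlt
  have h0 := noncentrality_nonneg hm.1
  have h1 := hm.one_le_card_union
  rw [Real.norm_of_nonneg (by positivity), Real.norm_of_nonneg (by positivity),
    inv_mul_eq_div, le_div_iff₀ (by positivity)] at h
  have h2 : (D n).noncentrality (m n) ^ β < (|K| + 1) ^ β :=
    Real.rpow_lt_rpow h0 (by linarith [le_abs_self K]) hβ
  have h3 := mul_le_mul_of_nonneg_right h1 (by positivity : 0 ≤ (|K| + 1) ^ β)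
  linarith

theorem meanPosterior_isLittleO_of_isNonSpurious
    (hm : ∀ᶠ n in atTop, (D n).IsNonSpurious (m n)) (hB2 : CondB2 D m) (hC2 : CondC2 D m)
    {τ₀ : ℝ} (hτ₀ : 0 < τ₀) (hτ : ∀ᶠ n in atTop, τ₀ ≤ (D n).τ)
    {α γ : ℝ} (hα : α < 1) (hγ : γ ≤ 1) :
    (fun n => (D n).meanPosterior (m n)) =o[atTop] fun n =>
      Real.exp (-γ * (D n).noncentrality (m n) / 2) +
        Real.exp (-γ * (D n).noncentrality (m n) ^ α / 2) := by
  refine isLittleO_iff.2 fun c hc => ?_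
  have hlim := tendsto_noncentrality hm hB2
  obtain ⟨β, ⟨hβ0, hβ1⟩, hβ⟩ := hB2
  set c₀ := τ₀ / (1 + τ₀) with hc₀_def
  have hc₀ : 0 < c₀ := by positivity
  have hε : 0 < c₀ / 64 := by positivity
  filter_upwards [hm, hτ, isLittleO_iff.1 hβ one_pos,
    -- The choice `ε = 1 / 2` cancels the term `(d / 2) log (1 + τ)` of `log g` exactly, whatever
    -- the sign of `d`, leaving `-log g ≤ λ ^ (1/2) / 2`.
    (hC2 (1 / 2) ⟨by norm_num, by norm_num⟩).2 (1 / 2) (by norm_num),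
    hlim.eventually (eventually_rpow_le_mul hα hε),
    hlim.eventually (eventually_rpow_le_mul hβ1 hε),
    hlim.eventually (eventually_rpow_le_mul (by norm_num : (1 / 2 : ℝ) < 1) hε),
    hlim.eventually_ge_atTop (-Real.log c / (c₀ / 64))]
    with n hm hτ hq hr h1 h2 h3 h4
  have hτ0 := (D n).τ_pos
  have hl := noncentrality_nonneg hm.1
  set l := (D n).noncentrality (m n)
  rw [one_mul, Real.norm_of_nonneg (by positivity), Real.norm_of_nonneg (by positivity)] at hq
  rw [div_le_iff₀ hε] at h4
  have hc1 : c₀ ≤ (D n).τ / (1 + (D n).τ) := by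
    rw [hc₀_def, div_le_div_iff₀ (by positivity) (by positivity)]
    linarith
  have hcl := mul_le_mul_of_nonneg_right hc1 hl
  have hLog := log_g hm.1
  have hlog2 := mul_le_mul_of_nonneg_left
    (Real.log_two_lt_d9.le.trans (by norm_num : _ ≤ (1 : ℝ)))
    (Nat.cast_nonneg (α := ℝ) ((D n).t ∪ m n).card)
  have hla : 0 ≤ l ^ α := by positivity
  have hγl := mul_le_mul_of_nonneg_right hγ hla
  rw [Real.norm_of_nonneg (meanPosterior_nonneg hm.1), Real.norm_of_nonneg (by positivity)]
  calc (D n).meanPosterior (m n) ≤ _ := meanPosterior_le_of_isNonSpurious hm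
    _ ≤ c * Real.exp (-γ * l ^ α / 2) := by
      rw [g_rpow_eq_exp hm.1, ← Real.rpow_natCast, Real.rpow_def_of_pos two_pos,
        ← Real.exp_add, ← Real.exp_add]
      conv_rhs => rw [← Real.exp_log hc, ← Real.exp_add]
      refine Real.exp_le_exp.2 ?_
      -- The decay `c₀ λ / 16` equals four units of `c₀ λ / 64`. The prior ratio, the dimension
      -- factor, the target exponent and `log c` use at most 1/8, 1, 1/2 and 1 of them.
      linarith
    _ ≤ _ := by
      refine mul_le_mul_of_nonneg_left ?_ hc.le
      linarith [Real.exp_pos (-γ * l / 2)]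

end ZellnerRegression

theorem proposition2 (D : ∀ n : ℕ, ZellnerRegression n) (m : ∀ n : ℕ, Finset (Fin (D n).p)) :
    ((∀ᶠ n in atTop, (D n).IsSpurious (m n)) → CondB1 D → CondC1 D m →
      ((fun n => (D n).meanPosterior (m n)) =O[atTop] fun n => (D n).logRate (m n)) ∧
      (∀ α ∈ Set.Ioo (0 : ℝ) 1,
        (fun n => (D n).meanPosterior (m n)) =o[atTop] fun n => (D n).powerRate α (m n)) ∧
      (((fun n => (D n).dimDiff (m n) * Real.log (Real.log ((D n).g (m n))))
          =o[atTop] fun n => Real.log ((D n).g (m n))) →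
        ∀ α ∈ Set.Ioo (0 : ℝ) 1,
          (fun n => (D n).logRate (m n)) =o[atTop] fun n => (D n).powerRate α (m n))) ∧
    ((∀ᶠ n in atTop, (D n).IsNonSpurious (m n)) → CondB2 D m → CondC2 D m →
      (∃ τ₀ > 0, ∀ᶠ n in atTop, τ₀ ≤ (D n).τ) →
      ∀ α' ∈ Set.Ioo (0 : ℝ) 1, ∀ γ ∈ Set.Ioo (0 : ℝ) 1,
        (fun n => (D n).meanPosterior (m n)) =o[atTop] fun n =>
          Real.exp (-γ * (D n).noncentrality (m n) / 2) +
            Real.exp (-γ * (D n).noncentrality (m n) ^ α' / 2)) := by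
  refine ⟨fun hm _ hC1 => ⟨ZellnerRegression.meanPosterior_isBigO_logRate hm hC1,
    fun α hα => ZellnerRegression.meanPosterior_isLittleO_powerRate hm hC1 hα,
    fun hlog α hα => ZellnerRegression.logRate_isLittleO_powerRate hm hC1 hlog hα⟩, ?_⟩
  rintro hm hB2 hC2 ⟨τ₀, hτ₀, hτ⟩ α hα γ hγ
  exact ZellnerRegression.meanPosterior_isLittleO_of_isNonSpurious hm hB2 hC2 hτ₀ hτ hα.2 hγ.2.le
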